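/- **Theorem (instability for smooth games).** Consider an $N$-player game in which player $i$ chooses $x_i\in\mathbb R$ and minimizes a cost $J_i:\mathbb R^N\to\mathbb R$ of class $C^2$ (for instance a smooth one). Let $F:\mathbb R^N\to\mathbb R^N$, $F(x)_i=\frac{\partial J_i}{\partial x_i}(x)$, be its pseudo-gradient. Let $x^\star$ be an isolated Nash equilibrium: $J_i(x^\star)\le J_i(x_i,x^\star_{-i})$ for all $i$ and all $x_i\in\mathbb R$ (so that $F(x^\star)=0$), and some neighbourhood of $x^\star$ contains no other Nash equilibrium. Let $G=DF(x^\star)\in\mathbb R^{N\times N}$. If $G$ has an eigenvalue $\lambda\in\mathbb C\setminus\mathbb R_{\ge 0}$, then for every initial time $t_0>0$ the equilibrium $x^\star$ is unstable for $$\ddot x(t)+\tfrac3t\,\dot x(t)+F(x(t))=0,\qquad t\ge t_0 .$$ Here $x^\star$ is *stable* (for initial time $t_0$) if for every $\varepsilon>0$ there is $\delta>0$ such that every solution with $\|x(t_0)-x^\star\|+\|\dot x(t_0)\|<\delta$ satisfies $\|x(t)-x^\star\|+\|\dot x(t)\|<\varepsilon$ at all times $t\ge t_0$ in its interval of existence,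 and *unstable* if it is not stable. -/

import Mathlib

open Set Filter Topology

namespace SmoothGame

/-- Joint actions of an `N`-player game in which every player controls one real number. -/
abbrev Action (N : ℕ) : Type := EuclideanSpace ℝ (Fin N)

/-- The joint action in which player `i` switches to `y` and all others keep their action. -/
noncomputable def deviate {N : ℕ} (x : Action N) (i : Fin N) (y : ℝ) : Action N :=
  WithLp.toLp 2 (Function.update (fun k => x k) i y)

/-- `x` is a Nash equilibrium of the game with cost functions `J i`: no player can reduce
their own cost by a unilateral deviation. -/
def IsNash {N : ℕ} (J : Fin N → Action N → ℝ) (x : Action N) : Prop :=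
  ∀ (i : Fin N) (y : ℝ), J i x ≤ J i (deviate x i y)

/-- A Nash equilibrium with a neighbourhood that contains no other Nash equilibrium. -/
def IsIsolatedNash {N : ℕ} (J : Fin N → Action N → ℝ) (x : Action N) : Prop :=
  IsNash J x ∧ ∃ r > 0, ∀ y, IsNash J y → dist y x < r → y = x

/-- The pseudo-gradient: `F(x)_i` is the partial derivative of `J i` in the `i`-th coordinate. -/
noncomputable def pseudoGradient {N : ℕ} (J : Fin N → Action N → ℝ) (x : Action N) : Action N :=
  WithLp.toLp 2 (fun i => fderiv ℝ (J i) x (EuclideanSpace.single i 1))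

/-- The Jacobian matrix of a vector field: the entry `(i, j)` is `∂F_i/∂x_j`. -/
noncomputable def jacobian {N : ℕ} (F : Action N → Action N) (x : Action N) :
    Matrix (Fin N) (Fin N) ℝ :=
  Matrix.of fun i j => fderiv ℝ F x (EuclideanSpace.single j 1) i

/-- `q`, with velocity `v`, solves `q'' + (3/t) q' + F(q) = 0` on the interval `[t₀, T]`. -/
def IsNAGDSolution {N : ℕ} (F : Action N → Action N) (t₀ T : ℝ) (q v : ℝ → Action N) : Prop :=
  ∀ t ∈ Icc t₀ T,
    HasDerivWithinAt q (v t) (Icc t₀ T) t ∧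
    HasDerivWithinAt v (-((3 / t) • v t) - F (q t)) (Icc t₀ T) t

/-- Stability of `xs` for the NAGD dynamics started at time `t₀`. Solutions of the nonlinear
equation need not exist for all times, so the bound is required on every interval `[t₀, T]` on
which the solution exists. For a locally Lipschitz `F` such a bound forces the maximal solutions
with small data to exist on all of `[t₀, ∞)` (they stay in a
compact set), so this is stability in the usual sense. -/
def IsStable {N : ℕ} (F : Action N → Action N) (xs : Action N) (t₀ : ℝ) : Prop :=
  ∀ ε > 0, ∃ δ > 0, ∀ (T : ℝ) (q v : ℝ → Action N),
    IsNAGDSolution F t₀ T q v → ‖q t₀ - xs‖ + ‖v t₀‖ < δ →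
      ∀ t ∈ Icc t₀ T, ‖q t - xs‖ + ‖v t‖ < ε

/-- Unstable means not stable. -/
def IsUnstable {N : ℕ} (F : Action N → Action N) (xs : Action N) (t₀ : ℝ) : Prop :=
  ¬ IsStable F xs t₀

end SmoothGame

/-! With `z = (x - xs, v)` the linearisation without friction is `z' = A z`, `A (x, v) = (v, -G x)`.
If `G w = λ w` and `μ² = -λ`, then `A (w, μ w) = μ (w, μ w)`; as `λ` is not in `[0, ∞)`, `μ` can be
taken with positive real part. A quadratic form `S` then has derivative `2γ S + I` along `A`, `I`
positive definite, and is positive somewhere (`exists_lyapunov_form`). Near `xs` and at late times,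
`I` absorbs the nonlinear remainder and the friction, so `S` grows exponentially
(`lyapunov_form_growth`), whereas stability keeps it bounded. Smallness is needed at `t₀`, growth
only starts at a later `T₀`: data are chosen at `T₀` and followed back to `t₀`, with Grönwall
controlling their size. -/

/-! ### Lyapunov forms of linear systems -/

/-- Shifting an endomorphism by a generic scalar makes it surjective. -/
theorem Module.End.exists_mem_Ioo_surjective_sub_smul {V : Type*} [AddCommGroup V] [Module ℝ V]
    [FiniteDimensional ℝ V] (L : Module.End ℝ V) {c d : ℝ} (hcd : c < d) :
    ∃ ν ∈ Ioo c d, ∀ w, ∃ v, L v - ν • v = w := by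
  obtain ⟨ν, hν, hν'⟩ : ∃ ν ∈ Ioo c d, ν ∉ {μ | L.HasEigenvalue μ} :=
    ((Ioo_infinite hcd).sdiff L.finite_hasEigenvalue).nonempty
  refine ⟨ν, hν, ?_⟩
  have hinj : Function.Injective (L - ν • (LinearMap.id : V →ₗ[ℝ] V)) :=
    (injective_iff_map_eq_zero _).2 fun v hv => by
      by_contra h0
      exact hν' (Module.End.hasEigenvalue_of_hasEigenvector
        (Module.End.hasEigenvector_iff.2 ⟨Module.End.mem_eigenspace_iff.2
          (by simpa [sub_eq_zero] using hv), h0⟩))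
  intro w
  obtain ⟨v, hv⟩ := LinearMap.injective_iff_surjective.1 hinj w
  exact ⟨v, by simpa using hv⟩

/-- A (not necessarily symmetric) bilinear form whose Lie derivative along `z' = A z` is the
positive form `I` plus a positive multiple of itself, and which is positive somewhere. -/
theorem exists_lyapunov_form {E : Type*} [NormedAddCommGroup E] [NormedSpace ℝ E]
    [FiniteDimensional ℝ E] (A : E →L[ℝ] E) (I : E →L[ℝ] E →L[ℝ] ℝ)
    (hI : ∀ z, ‖z‖ ^ 2 ≤ I z z) {α β : ℝ} (hα : 0 < α) {a b : E}
    (ha : A a = α • a - β • b) (hb : A b = β • a + α • b) (hab : a ≠ 0 ∨ b ≠ 0) :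
    ∃ γ > 0, ∃ S : E →L[ℝ] E →L[ℝ] ℝ,
      (∀ z, S (A z) z + S z (A z) = 2 * γ * S z z + I z z) ∧ ∃ z, 0 < S z z := by
  let L : Module.End ℝ (E →L[ℝ] E →L[ℝ] ℝ) :=
    { toFun := fun S => S.comp A + S.bilinearComp (ContinuousLinearMap.id ℝ E) A
      map_add' := fun S T => by
        ext x y
        change S (A x) y + T (A x) y + (S x (A y) + T x (A y)) =
          S (A x) y + S x (A y) + (T (A x) y + T x (A y))
        ring
      map_smul' := fun c S => by
        ext x y
        change c * S (A x) y + c * S x (A y) = c * (S (A x) y + S x (A y))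
        ring }
  have hL : ∀ S x y, L S x y = S (A x) y + S x (A y) := fun S x y => rfl
  -- `ν` will be `2γ`: `ν > 0` gives growth, `ν < 2α` gives positivity of `S` on `a` or `b`.
  obtain ⟨ν, ⟨hν0, hνα⟩, hν⟩ :=
    Module.End.exists_mem_Ioo_surjective_sub_smul (V := E →L[ℝ] E →L[ℝ] ℝ) L (show (0 : ℝ) < 2 * α by linarith)
  obtain ⟨S, hS⟩ := hν I
  have hS' : ∀ z, S (A z) z + S z (A z) = ν * S z z + I z z := fun z => by
    have h : L S z z - ν * S z z = I z z := congrArg (fun T => T z z) hS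
    rw [hL] at h
    linarith
  refine ⟨ν / 2, by linarith, S, fun z => by rw [hS']; ring, ?_⟩
  have h1 := hS' a
  have h2 := hS' b
  rw [ha] at h1
  rw [hb] at h2
  simp only [map_sub, map_add, map_smul, sub_apply, add_apply, smul_apply, smul_eq_mul] at h1 h2
  have h3 : 0 < I a a + I b b := by
    have h4 := hI a
    have h5 := hI b
    rcases hab with h | h <;> have := norm_pos_iff.2 h
    · nlinarith [sq_nonneg ‖b‖]
    · nlinarith [sq_nonneg ‖a‖]
  -- The cross terms in `β` cancel in the sum.
  have h6 : (2 * α - ν) * (S a a + S b b) = I a a + I b b := by linarith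
  have h7 : 0 < S a a + S b b := pos_of_mul_pos_right (h6 ▸ h3) (by linarith)
  by_contra! h
  linarith [h a, h b]

/-- Along a perturbation of `z' = A z` a Lyapunov form grows exponentially. -/
theorem lyapunov_form_growth {E : Type*} [NormedAddCommGroup E] [NormedSpace ℝ E]
    {A : E →L[ℝ] E} {I S : E →L[ℝ] E →L[ℝ] ℝ} (hI : ∀ z, ‖z‖ ^ 2 ≤ I z z) {γ κ : ℝ}
    (hS : ∀ z, S (A z) z + S z (A z) = 2 * γ * S z z + I z z) (hκ : 2 * ‖S‖ * κ ≤ 1)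
    {z g : ℝ → E} {t₀ T : ℝ} (hT : t₀ ≤ T)
    (hz : ∀ t ∈ Icc t₀ T, HasDerivWithinAt z (A (z t) + g t) (Icc t₀ T) t)
    (hg : ∀ t ∈ Icc t₀ T, ‖g t‖ ≤ κ * ‖z t‖) :
    Real.exp (2 * γ * (T - t₀)) * S (z t₀) (z t₀) ≤ S (z T) (z T) := by
  -- The discount removes `2γ S`; what is left, `I` plus errors of size at most `2‖S‖κ‖z‖²`, is
  -- nonnegative.
  let W : ℝ → ℝ := fun t => Real.exp (-(2 * γ * (t - t₀))) * S (z t) (z t)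
  have hW : ∀ t ∈ Icc t₀ T, HasDerivWithinAt W
      (Real.exp (-(2 * γ * (t - t₀))) * (I (z t) (z t) + S (g t) (z t) + S (z t) (g t)))
      (Icc t₀ T) t := fun t ht => by
    have h1 : HasDerivWithinAt (fun t => Real.exp (-(2 * γ * (t - t₀))))
        (Real.exp (-(2 * γ * (t - t₀))) * (-(2 * γ * 1))) (Icc t₀ T) t :=
      ((((hasDerivAt_id t).sub_const t₀).const_mul (2 * γ)).neg.exp).hasDerivWithinAt
    have h2 := (S.hasFDerivAt.comp_hasDerivWithinAt t (hz t ht)).clm_apply (hz t ht)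
    refine (h1.mul h2).congr_deriv ?_
    have := hS (z t)
    change _ + Real.exp (-(2 * γ * (t - t₀))) *
      (S (A (z t) + g t) (z t) + S (z t) (A (z t) + g t)) = _
    simp only [map_add, add_apply, Function.comp_apply]
    linear_combination Real.exp (-(2 * γ * (t - t₀))) * this
  have hmono : MonotoneOn W (Icc t₀ T) := by
    refine monotoneOn_of_deriv_nonneg (convex_Icc _ _)
      (fun t ht => (hW t ht).continuousWithinAt)
      (fun t ht => ?_) fun t ht => ?_
    · exact ((hW t (interior_subset ht)).mono interior_subset).differentiableWithinAt
    · have ht' := interior_subset ht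
      rw [((hW t ht').hasDerivAt (mem_interior_iff_mem_nhds.1 ht)).deriv]
      refine mul_nonneg (Real.exp_pos _).le ?_
      have h1 := S.le_opNorm₂ (g t) (z t)
      have h2 := S.le_opNorm₂ (z t) (g t)
      rw [Real.norm_eq_abs] at h1 h2
      have h3 := hI (z t)
      have h4 : ‖S‖ * ‖z t‖ * ‖g t‖ ≤ ‖S‖ * ‖z t‖ * (κ * ‖z t‖) :=
        mul_le_mul_of_nonneg_left (hg t ht') (by positivity)
      have h5 := mul_le_mul_of_nonneg_right hκ (sq_nonneg ‖z t‖)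
      linarith [neg_abs_le (S (g t) (z t)), neg_abs_le (S (z t) (g t))]
  have h := hmono (left_mem_Icc.2 hT) (right_mem_Icc.2 hT) hT
  simp only [W, sub_self, mul_zero, neg_zero] at h
  rwa [Real.exp_neg, inv_mul_eq_div, Real.exp_zero, one_mul, le_div_iff₀ (Real.exp_pos _),
    mul_comm] at h

/-! ### Existence and size of ODE solutions -/

/-- A bounded, globally Lipschitz vector field has a solution on every compact interval. -/
theorem exists_solution_of_bounded_lipschitz {E : Type*} [NormedAddCommGroup E] [NormedSpace ℝ E]
    [CompleteSpace E] {f : ℝ → E → E} {tmin t₀ tmax : ℝ} (h₁ : tmin ≤ t₀) (h₂ : t₀ ≤ tmax)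
    {K L : NNReal} (hlip : ∀ t ∈ Icc tmin tmax, LipschitzWith K (f t))
    (hcont : ∀ x, ContinuousOn (f · x) (Icc tmin tmax))
    (hbound : ∀ t ∈ Icc tmin tmax, ∀ x, ‖f t x‖ ≤ L) (x₀ : E) :
    ∃ z : ℝ → E, z t₀ = x₀ ∧
      ∀ t ∈ Icc tmin tmax, HasDerivWithinAt z (f t (z t)) (Icc tmin tmax) t := by
  let m : NNReal := ⟨max (tmax - t₀) (t₀ - tmin), le_max_of_le_left (by linarith)⟩
  -- Speed at most `L` for time at most `m` cannot leave the ball of radius `L * m`.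
  have h : IsPicardLindelof f (⟨t₀, h₁, h₂⟩ : Icc tmin tmax) x₀ (L * m) 0 L K :=
    { lipschitzOnWith := fun t ht => (hlip t ht).lipschitzOnWith
      continuousOn := fun x _ => hcont x
      norm_le := fun t ht x _ => hbound t ht x
      mul_max_le := by simp only [NNReal.coe_mul, NNReal.coe_zero, sub_zero]; exact le_rfl }
  exact h.exists_eq_forall_mem_Icc_hasDerivWithinAt₀

/-- Backward Grönwall estimate for a linearly bounded derivative. -/
theorem norm_le_mul_exp_of_norm_deriv_le {E : Type*} [NormedAddCommGroup E] [NormedSpace ℝ E]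
    {z z' : ℝ → E} {a b K : ℝ} (hK : 0 ≤ K)
    (hz : ∀ t ∈ Icc a b, HasDerivWithinAt z (z' t) (Icc a b) t)
    (hbound : ∀ t ∈ Icc a b, ‖z' t‖ ≤ K * ‖z t‖) :
    ∀ t ∈ Icc a b, ‖z t‖ ≤ ‖z b‖ * Real.exp (K * (b - a)) := by
  have hrev : ∀ s ∈ Icc a b, a + b - s ∈ Icc a b := fun s hs =>
    ⟨by linarith [hs.2], by linarith [hs.1]⟩
  have hw : ∀ s ∈ Icc a b, HasDerivWithinAt (fun s => z (a + b - s)) (-z' (a + b - s))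
      (Icc a b) s := fun s hs => by
    have h1 : HasDerivWithinAt (fun s => a + b - s) (-1) (Icc a b) s :=
      ((hasDerivAt_id s).const_sub (a + b)).hasDerivWithinAt
    have h2 := (hz _ (hrev s hs)).scomp s h1 hrev
    rwa [neg_one_smul] at h2
  intro t ht
  have h := norm_le_gronwallBound_of_norm_deriv_right_le (δ := ‖z b‖) (K := K) (ε := 0)
    (fun s hs => (hw s hs).continuousWithinAt)
    (fun s hs => (hw s (Ico_subset_Icc_self hs)).mono_of_mem_nhdsWithin
      (Icc_mem_nhdsGE_of_mem hs)) (by simp)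
    (fun s hs => by simpa using hbound _ (hrev s (Ico_subset_Icc_self hs))) _ (hrev t ht)
  rw [gronwallBound_ε0] at h
  simp only [sub_sub_cancel] at h
  refine h.trans ?_
  gcongr
  linarith [ht.1]

/-- A `C¹` map vanishing at the origin of a finite-dimensional space agrees on any given ball with
a bounded, globally Lipschitz map. -/
theorem exists_bounded_lipschitz_eqOn_closedBall {E F : Type*} [NormedAddCommGroup E]
    [NormedSpace ℝ E] [FiniteDimensional ℝ E] [NormedAddCommGroup F] [NormedSpace ℝ F]
    {f : E → F} (hf : ContDiff ℝ 1 f) {r : ℝ} (hr : 0 < r) :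
    ∃ (g : E → F) (K L : NNReal), LipschitzWith K g ∧ (∀ x, ‖g x‖ ≤ L) ∧
      ∀ x, ‖x‖ ≤ r → g x = f x := by
  let χ : ContDiffBump (0 : E) := ⟨r, r + 1, hr, by linarith⟩
  have hc : HasCompactSupport (fun x => χ x • f x) := χ.hasCompactSupport.smul_right
  have hg : ContDiff ℝ 1 (fun x => χ x • f x) := χ.contDiff.smul hf
  obtain ⟨K, hK⟩ := hg.lipschitzWith_of_hasCompactSupport hc one_ne_zero
  obtain ⟨L, hL⟩ := hc.exists_bound_of_continuous hg.continuous
  refine ⟨_, K, L.toNNReal, hK, fun x => (hL x).trans (Real.le_coe_toNNReal L), fun x hx => ?_⟩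
  rw [χ.one_of_mem_closedBall (by simpa [χ] using hx), one_smul]

/-! ### Instability from an expanding plane -/

namespace SmoothGame

/-- Two real vectors spanning an expanding invariant plane of the linearised first-order system
`(x, v) ↦ (v, -DF(xs) x)` make a zero of a `C¹` field unstable for the NAGD dynamics. -/
theorem isUnstable_of_expanding_pair {N : ℕ} {F : Action N → Action N} (hF : ContDiff ℝ 1 F)
    {xs : Action N} (hxs : F xs = 0) {α β : ℝ} (hα : 0 < α) {a b : Action N × Action N}
    (ha : (a.2, -fderiv ℝ F xs a.1) = α • a - β • b)
    (hb : (b.2, -fderiv ℝ F xs b.1) = β • a + α • b) (hab : a ≠ 0 ∨ b ≠ 0)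
    {t₀ : ℝ} (ht₀ : 0 < t₀) : IsUnstable F xs t₀ := by
  intro hst
  set D := fderiv ℝ F xs with hD
  let A : Action N × Action N →L[ℝ] Action N × Action N :=
    (ContinuousLinearMap.snd ℝ (Action N) (Action N)).prod
      (-(D.comp (ContinuousLinearMap.fst ℝ (Action N) (Action N))))
  let I : Action N × Action N →L[ℝ] Action N × Action N →L[ℝ] ℝ :=
    (innerSL ℝ).bilinearComp (ContinuousLinearMap.fst ℝ _ _) (ContinuousLinearMap.fst ℝ _ _) +
    (innerSL ℝ).bilinearComp (ContinuousLinearMap.snd ℝ _ _) (ContinuousLinearMap.snd ℝ _ _)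
  have hA : ∀ z, A z = (z.2, -D z.1) := fun z => rfl
  have hI : ∀ z, ‖z‖ ^ 2 ≤ I z z := fun z => by
    have : I z z = ‖z.1‖ ^ 2 + ‖z.2‖ ^ 2 := by simp [I]
    rw [this, Prod.norm_def]
    rcases max_choice ‖z.1‖ ‖z.2‖ with h | h <;> rw [h]
    · linarith [sq_nonneg ‖z.2‖]
    · linarith [sq_nonneg ‖z.1‖]
  obtain ⟨γ, hγ, S, hS, z₁, hz₁⟩ := exists_lyapunov_form A I hI hα ha hb hab
  -- Friction and remainder each cost `c‖z‖`, so `κ = 2c` below.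
  set c : ℝ := 1 / (4 * (‖S‖ + 1)) with hc
  have hS0 := norm_nonneg S
  have hc0 : 0 < c := by positivity
  have hSc : 2 * ‖S‖ * (2 * c) ≤ 1 := by
    rw [hc, ← mul_assoc, mul_one_div, div_le_one (by positivity)]
    linarith
  obtain ⟨r, hr, hrem⟩ : ∃ r > 0, ∀ x, ‖x‖ ≤ r → ‖F (xs + x) - D x‖ ≤ c * ‖x‖ := by
    have h := (hF.differentiable one_ne_zero xs).hasFDerivAt.isLittleO.bound hc0
    obtain ⟨r, hr, h⟩ := Metric.eventually_nhds_iff.1 h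
    refine ⟨r / 2, by linarith, fun x hx => ?_⟩
    have := h (y := xs + x) (by simpa [dist_eq_norm] using by linarith)
    simpa [hxs] using this
  obtain ⟨δ, hδ, hstab⟩ := hst r hr
  set T₀ := max t₀ (3 / c) with hT₀
  have htT₀ : t₀ ≤ T₀ := le_max_left _ _
  have h3T₀ : ∀ t, T₀ ≤ t → 3 / t ≤ c := fun t ht => by
    have h1 : 3 / c ≤ t := (le_max_right _ _).trans ht
    have h2 : 0 < t := lt_of_lt_of_le (by positivity) h1
    rw [div_le_iff₀ hc0] at h1
    rw [div_le_iff₀ h2]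
    linarith
  -- Cutting off the autonomous and friction parts separately gives bounds uniform in `t ≥ t₀`.
  obtain ⟨g₁, K₁, L₁, hK₁, hL₁, hg₁⟩ := exists_bounded_lipschitz_eqOn_closedBall
    (f := fun z : Action N × Action N => (z.2, -F (xs + z.1))) (by fun_prop) hr
  obtain ⟨g₂, K₂, L₂, hK₂, hL₂, hg₂⟩ := exists_bounded_lipschitz_eqOn_closedBall
    (f := fun z : Action N × Action N => ((0 : Action N), z.2)) (by fun_prop) hr
  have hg₁0 : g₁ 0 = 0 := by rw [hg₁ 0 (by simpa using hr.le)]; simp [hxs]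
  have hg₂0 : g₂ 0 = 0 := by rw [hg₂ 0 (by simpa using hr.le)]; simp
  let f : ℝ → Action N × Action N → Action N × Action N := fun t z => g₁ z - (3 / t) • g₂ z
  let m : NNReal := ⟨3 / t₀, by positivity⟩
  have hm : ∀ t, t₀ ≤ t → ‖3 / t‖₊ ≤ m := fun t ht => by
    rw [← NNReal.coe_le_coe, coe_nnnorm, Real.norm_of_nonneg (by have := ht₀.trans_le ht; positivity)]
    exact div_le_div_of_nonneg_left (by norm_num) ht₀ ht
  set K : NNReal := K₁ + m * K₂ with hK
  have hlip : ∀ t, t₀ ≤ t → LipschitzWith K (f t) := fun t ht =>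
    (hK₁.sub ((lipschitzWith_smul (3 / t)).comp hK₂)).weaken (by
      rw [hK]; gcongr; exact hm t ht)
  have hbound : ∀ t, t₀ ≤ t → ∀ z, ‖f t z‖ ≤ (L₁ + m * L₂ : NNReal) := fun t ht z => by
    refine (norm_sub_le _ _).trans ?_
    rw [norm_smul]
    push_cast
    exact add_le_add (hL₁ z) (mul_le_mul (hm t ht) (hL₂ z) (norm_nonneg _) m.2)
  have hlin : ∀ t, t₀ ≤ t → ∀ z, ‖f t z‖ ≤ K * ‖z‖ := fun t ht z => by
    have h := (hlip t ht).dist_le_mul z 0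
    have h0 : f t 0 = 0 := by simp [f, hg₁0, hg₂0]
    rwa [h0, dist_zero_right, dist_zero_right] at h
  -- a small initial point at time `T₀` in the direction where the form is positive
  set M := Real.exp (K * (T₀ - t₀)) with hM
  have hM0 : 0 < M := Real.exp_pos _
  -- `M` bounds the backward growth; the 2 compares a sum of norms with the sup norm on the product.
  obtain ⟨z₀, hz₀S, hz₀r, hz₀δ⟩ : ∃ z₀, 0 < S z₀ z₀ ∧ ‖z₀‖ * M < r ∧ 2 * (‖z₀‖ * M) < δ := by
    have hlim : Tendsto (fun s : ℝ => ‖s • z₁‖ * M) (𝓝[>] 0) (𝓝 0) := by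
      have : Continuous fun s : ℝ => ‖s • z₁‖ * M := by fun_prop
      simpa using (this.tendsto 0).mono_left nhdsWithin_le_nhds
    obtain ⟨s, ⟨hs1, hs2⟩, hs0⟩ := (((hlim.eventually_lt_const hr).and
      (hlim.eventually_lt_const (half_pos hδ))).and self_mem_nhdsWithin).exists
    have hs0 : 0 < s := hs0
    refine ⟨s • z₁, ?_, hs1, by linarith⟩
    simp only [map_smul, smul_apply, smul_eq_mul]
    positivity
  -- Chosen so that `exp s ≥ 1 + s` pushes `S` past its bound `‖S‖ r²` on the ball.
  set τ := ‖S‖ * r ^ 2 / (2 * γ * S z₀ z₀) with hτ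
  have hτ0 : 0 ≤ τ := by positivity
  set T := T₀ + τ with hT
  have hTT : T₀ ≤ T := by linarith
  obtain ⟨z, hzT₀, hz⟩ := exists_solution_of_bounded_lipschitz htT₀ hTT
    (fun t ht => hlip t ht.1) (fun x => by
      have h : ContinuousOn (fun t : ℝ => 3 / t) (Icc t₀ T) :=
        continuousOn_const.div continuousOn_id fun t ht => (ht₀.trans_le ht.1).ne'
      exact continuousOn_const.sub (h.fun_smul continuousOn_const))
    (fun t ht => hbound t ht.1) z₀
  have hcontz : ContinuousOn z (Icc t₀ T) := fun t ht => (hz t ht).continuousWithinAt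
  have hsub : Icc t₀ T₀ ⊆ Icc t₀ T := Icc_subset_Icc_right hTT
  have hearly : ∀ t ∈ Icc t₀ T₀, ‖z t‖ ≤ ‖z₀‖ * M := by
    have := norm_le_mul_exp_of_norm_deriv_le K.2
      (fun t ht => (hz t (hsub ht)).mono hsub) (fun t ht => hlin t ht.1 (z t))
    rwa [hzT₀] at this
  have hstart : ‖(z t₀).1‖ + ‖(z t₀).2‖ < δ := by
    have := hearly t₀ ⟨le_rfl, htT₀⟩
    linarith [norm_fst_le (z t₀), norm_snd_le (z t₀)]
  have hf : ∀ t z, ‖z‖ ≤ r → f t z = (z.2, -((3 / t) • z.2) - F (xs + z.1)) := fun t z hz => by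
    simp only [f]
    rw [hg₁ z hz, hg₂ z hz]
    ext1
    · simp
    · simp only [Prod.snd_sub, Prod.smul_snd]; abel
  -- inside the ball the solution of the modified system solves the original equation
  have hsol : ∀ t₁ ∈ Icc t₀ T, (∀ t ∈ Icc t₀ t₁, ‖z t‖ ≤ r) → ‖z t₁‖ < r := by
    intro t₁ ht₁ hle
    have hsub₁ : Icc t₀ t₁ ⊆ Icc t₀ T := Icc_subset_Icc_right ht₁.2
    have h := hstab t₁ (fun t => xs + (z t).1) (fun t => (z t).2) (fun t ht => by
      have h1 := (hz t (hsub₁ ht)).mono hsub₁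
      rw [hf t _ (hle t ht)] at h1
      exact ⟨h1.fst.const_add xs, h1.snd⟩) (by simpa using hstart) t₁ ⟨ht₁.1, le_rfl⟩
    rw [add_sub_cancel_left] at h
    rw [Prod.norm_def]
    exact max_lt (by linarith [norm_nonneg (z t₁).2]) (by linarith [norm_nonneg (z t₁).1])
  -- At a first exit time `t₁` the norm is at most `r` on `[t₀, t₁]`, so `hsol` makes it smaller
  -- than `r` at `t₁`.
  have hball : ∀ t ∈ Icc t₀ T, ‖z t‖ < r := by
    by_contra! hex
    have hclosed : IsClosed (Icc t₀ T ∩ (fun t => ‖z t‖) ⁻¹' Ici r) :=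
      hcontz.norm.preimage_isClosed_of_isClosed isClosed_Icc isClosed_Ici
    have hcomp : IsCompact (Icc t₀ T ∩ (fun t => ‖z t‖) ⁻¹' Ici r) :=
      isCompact_Icc.of_isClosed_subset hclosed inter_subset_left
    obtain ⟨t₁, ⟨ht₁, hrt₁⟩, hmin⟩ := hcomp.exists_isLeast hex
    have hlt : ∀ t ∈ Ico t₀ t₁, ‖z t‖ < r := fun t ht => by
      by_contra! h
      exact ht.2.not_ge (hmin ⟨⟨ht.1, ht.2.le.trans ht₁.2⟩, h⟩)
    have hne : t₀ < t₁ := by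
      refine lt_of_le_of_ne ht₁.1 fun h => ?_
      have := hearly t₀ ⟨le_rfl, htT₀⟩
      rw [← h] at hrt₁
      exact (this.trans_lt hz₀r).not_ge hrt₁
    have hle : ∀ t ∈ Icc t₀ t₁, ‖z t‖ ≤ r := by
      have h := hcontz.norm.mono (Icc_subset_Icc_right ht₁.2)
      rw [← closure_Ico hne.ne] at h ⊢
      exact fun t ht => le_on_closure (fun t ht => (hlt t ht).le) h continuousOn_const ht
    exact (hsol t₁ ht₁ hle).not_ge hrt₁
  -- exponential growth of the form
  have hgrow := lyapunov_form_growth hI hS hSc hTT (z := z) (g := fun t => f t (z t) - A (z t))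
    (fun t ht => by
      rw [add_sub_cancel]
      exact (hz t ⟨htT₀.trans ht.1, ht.2⟩).mono (Icc_subset_Icc_left htT₀))
    (fun t ht => by
      have ht' : t ∈ Icc t₀ T := ⟨htT₀.trans ht.1, ht.2⟩
      have hzt := (hball t ht').le
      have h1 := hrem (z t).1 ((norm_fst_le _).trans hzt)
      have h2 := h3T₀ t ht.1
      have h3 : 0 < t := ht₀.trans_le ht'.1
      have h4 := norm_fst_le (z t)
      have h5 := norm_snd_le (z t)
      have h6 : f t (z t) - A (z t) = (0, -((3 / t) • (z t).2) - (F (xs + (z t).1) - D (z t).1)) := by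
        rw [hf t _ hzt, hA]
        ext1
        · simp
        · simp only [Prod.snd_sub]; abel
      rw [h6, Prod.norm_def, norm_zero, max_eq_right (norm_nonneg _)]
      refine (norm_sub_le _ _).trans ?_
      rw [norm_neg, norm_smul, Real.norm_of_nonneg (by positivity)]
      have h7 : 3 / t * ‖(z t).2‖ ≤ c * ‖z t‖ := by gcongr
      have h8 : c * ‖(z t).1‖ ≤ c * ‖z t‖ := by gcongr
      linarith)
  rw [hzT₀, hT, add_sub_cancel_left, ← hT] at hgrow
  have h1 : S (z T) (z T) ≤ ‖S‖ * r ^ 2 := by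
    have h2 := S.le_opNorm₂ (z T) (z T)
    have h3 := (hball T ⟨htT₀.trans hTT, le_rfl⟩).le
    calc S (z T) (z T) ≤ ‖S‖ * ‖z T‖ * ‖z T‖ := (le_abs_self _).trans h2
      _ ≤ ‖S‖ * r * r := by gcongr
      _ = ‖S‖ * r ^ 2 := by ring
  have h2 : (2 * γ * τ + 1) * S z₀ z₀ ≤ ‖S‖ * r ^ 2 :=
    (mul_le_mul_of_nonneg_right (Real.add_one_le_exp _) hz₀S.le).trans (hgrow.trans h1)
  have h3 : 2 * γ * τ * S z₀ z₀ = ‖S‖ * r ^ 2 := by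
    rw [hτ]; field_simp
  linarith

/-! ### Nash equilibria and the complex eigenvector -/

theorem contDiff_pseudoGradient {N : ℕ} {J : Fin N → Action N → ℝ}
    (hJ : ∀ i, ContDiff ℝ 2 (J i)) : ContDiff ℝ 1 (pseudoGradient J) := by
  rw [contDiff_euclidean]
  exact fun i => ((hJ i).fderiv_right (m := 1) (by norm_num)).clm_apply contDiff_const

theorem deviate_eq_add {N : ℕ} (x : Action N) (i : Fin N) (y : ℝ) :
    deviate x i y = x + (y - x i) • EuclideanSpace.single i 1 := by
  ext k
  rcases eq_or_ne k i with rfl | h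
  · simp [deviate]
  · simp [deviate, h]

/-- The pseudo-gradient vanishes at a Nash equilibrium. -/
theorem IsNash.pseudoGradient_eq_zero {N : ℕ} {J : Fin N → Action N → ℝ}
    (hJ : ∀ i, Differentiable ℝ (J i)) {x : Action N} (hx : IsNash J x) :
    pseudoGradient J x = 0 := by
  ext i
  have hline : HasDerivAt (fun y : ℝ => deviate x i y) (EuclideanSpace.single i 1) (x i) := by
    simp only [deviate_eq_add]
    simpa using (((hasDerivAt_id (x i)).sub_const (x i)).smul_const
      (EuclideanSpace.single i (1 : ℝ))).const_add x
  have hself : deviate x i (x i) = x := by simp [deviate_eq_add]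
  have hd : HasDerivAt (fun y : ℝ => J i (deviate x i y))
      (fderiv ℝ (J i) x (EuclideanSpace.single i 1)) (x i) :=
    HasFDerivAt.comp_hasDerivAt (x i) (by rw [hself]; exact (hJ i x).hasFDerivAt) hline
  have hmin : IsLocalMin (fun y : ℝ => J i (deviate x i y)) (x i) :=
    Eventually.of_forall fun y => by simpa only [hself] using hx i y
  exact hmin.hasDerivAt_eq_zero hd

theorem fderiv_apply_eq_sum_jacobian {N : ℕ} (F : Action N → Action N) (x w : Action N) (i : Fin N) :
    fderiv ℝ F x w i = ∑ j, jacobian F x i j * w j := by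
  have hw : w = ∑ j, w j • EuclideanSpace.single j (1 : ℝ) := by
    ext k
    simp [Finset.sum_apply, Pi.single_apply]
  conv_lhs => rw [hw]
  simp [jacobian, mul_comm]

/-- Every complex number that is not a nonpositive real has a square root in the open right
half-plane. -/
theorem exists_sq_eq_re_pos {ζ : ℂ} (hζ : ¬ ∃ r : ℝ, 0 ≤ r ∧ -ζ = r) :
    ∃ μ : ℂ, μ * μ = ζ ∧ 0 < μ.re := by
  obtain ⟨μ, rfl⟩ := IsAlgClosed.exists_eq_mul_self ζ
  rcases lt_trichotomy μ.re 0 with h | h | h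
  · exact ⟨-μ, by ring, by simpa using h⟩
  · refine absurd ⟨μ.im ^ 2, sq_nonneg _, ?_⟩ hζ
    apply Complex.ext <;> simp [h, sq]
  · exact ⟨μ, rfl, h⟩

end SmoothGame

theorem mainTheorem11 {N : ℕ} (J : Fin N → SmoothGame.Action N → ℝ)
    (hJ : ∀ i, ContDiff ℝ 2 (J i))
    (xs : SmoothGame.Action N) (hxs : SmoothGame.IsIsolatedNash J xs)
    (lam : ℂ)
    (hlam : Module.End.HasEigenvalue
      (Matrix.toLin' ((SmoothGame.jacobian (SmoothGame.pseudoGradient J) xs).map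
        (fun r : ℝ => (r : ℂ)))) lam)
    (hneg : ¬ ∃ r : ℝ, 0 ≤ r ∧ lam = (r : ℂ))
    (t₀ : ℝ) (ht₀ : 0 < t₀) :
    SmoothGame.IsUnstable (SmoothGame.pseudoGradient J) xs t₀ := by
  obtain ⟨w, hw, hw0⟩ := hlam.exists_hasEigenvector
  obtain ⟨μ, hμ, hμre⟩ := SmoothGame.exists_sq_eq_re_pos (ζ := -lam) (by simpa using hneg)
  have hG : ∀ i, ∑ j, (SmoothGame.jacobian (SmoothGame.pseudoGradient J) xs i j : ℂ) * w j =
      lam * w i := fun i => by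
    have := congrFun (Module.End.mem_eigenspace_iff.1 hw) i
    simpa [Matrix.mulVec, dotProduct] using this
  let re : (Fin N → ℂ) → SmoothGame.Action N := fun u => WithLp.toLp 2 fun i => (u i).re
  let im : (Fin N → ℂ) → SmoothGame.Action N := fun u => WithLp.toLp 2 fun i => (u i).im
  have hre : fderiv ℝ (SmoothGame.pseudoGradient J) xs (re w) = re (lam • w) := by
    ext i
    rw [SmoothGame.fderiv_apply_eq_sum_jacobian]
    simpa [re] using congrArg Complex.re (hG i)
  have him : fderiv ℝ (SmoothGame.pseudoGradient J) xs (im w) = im (lam • w) := by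
    ext i
    rw [SmoothGame.fderiv_apply_eq_sum_jacobian]
    simpa [im] using congrArg Complex.im (hG i)
  have hlamμ : lam = -(μ * μ) := by rw [hμ, neg_neg]
  -- The pair is the real and imaginary part of `(w, μ w)`.
  refine SmoothGame.isUnstable_of_expanding_pair (SmoothGame.contDiff_pseudoGradient hJ)
    (hxs.1.pseudoGradient_eq_zero fun i => (hJ i).differentiable two_ne_zero) hμre (β := μ.im)
    (a := (re w, re (μ • w))) (b := (im w, im (μ • w))) ?_ ?_ ?_ ht₀
  · rw [hre]
    ext i <;> simp [re, im, hlamμ]; ring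
  · rw [him]
    ext i <;> simp [re, im, hlamμ] <;> ring
  · by_contra! h
    refine hw0 (funext fun i => Complex.ext ?_ ?_)
    · simpa [re] using congrArg (fun z => z.1 i) h.1
    · simpa [im] using congrArg (fun z => z.1 i) h.2
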